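/- Let $n\ge 4$ and let $A$ be an $n\times n$ complex Hermitian matrix. The principal minor map sends $M\in\mathbb{C}^{n\times n}$ to the vector $(\det M[S,S])_{S\subseteq\{1,\dots,n\}}$ of its principal minors (the minor for $S=\emptyset$ being $1$), and the fiber of $A$ is the set of all $B\in\mathbb{C}^{n\times n}$ with the same principal minors as $A$. For a square matrix $M$ whose rows and columns are indexed by a finite set $T$, write $f_M=\det(\mathrm{diag}(x_i : i\in T)+M)\in\mathbb{C}[x_i : i\in T]$ for its determinantal polynomial. Two matrices $M,N$ are diagonally equivalent if $M=DND^{-1}$ or $M=DN^{T}D^{-1}$ for some invertible diagonal matrix $D$. A matrix is reducible if, after a simultaneous permutation of its rows and columns, it is block upper triangular with at least two (nonempty) diagonal blocks; it is irreducible if it has positive size and is not reducible. All block forms below are understood after a simultaneous permutation of rows and columns, and a diagonal block keeps as its index set the corresponding subset of $\{1,\dots,n\}$. (a) If $A$ is irreducible, then a matrix $B\in\mathbb{C}^{n\times n}$ lies in the fiber of $A$ if and only if $B$ is diagonally equivalent to an irreducible Hermitian matrix that lies in the fiber of $A$. (b) If $A$ is not irreducible, then for some $s\ge 2$ the matrix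 $A$ is completely reducible with $s$ blocks, that is, it can be written as a block diagonal matrix with $s$ irreducible diagonal blocks $A_1,\dots,A_s$; moreover $f_A=f_{A_1}\cdots f_{A_s}$, where each $f_{A_k}$ is an irreducible polynomial in $\mathbb{C}[x_1,\dots,x_n]$; and a matrix $B\in\mathbb{C}^{n\times n}$ lies in the fiber of $A$ if and only if $B$ can be written as a block upper triangular matrix with $s$ irreducible diagonal blocks $B_1,\dots,B_s$ such that each $B_k$ is diagonally equivalent to an irreducible Hermitian matrix and, for some permutation $\pi$ of $\{1,\dots,s\}$, $f_{B_k}=f_{A_{\pi(k)}}$ for all $k$. -/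

import Mathlib

namespace PrincipalMinors

/-- The principal minor map: it sends `A` to the family of all its principal minors `A_S`, where
`S` runs over all subsets of the index set (the minor for `S = ∅` is `1`). -/
def principalMinorMap {ι K : Type*} [DecidableEq ι] [CommRing K] (A : Matrix ι ι K) :
    Finset ι → K :=
  fun S => (A.submatrix (Subtype.val : S → ι) (Subtype.val : S → ι)).det

/-- The fiber of `A` under the principal minor map, among all square matrices. -/
def fiber {ι K : Type*} [DecidableEq ι] [CommRing K] (A : Matrix ι ι K) : Set (Matrix ι ι K) :=
  {B | principalMinorMap B = principalMinorMap A}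

/-- The determinantal polynomial `f_A = det (diag (x_i) + A)`. -/
noncomputable def detPoly {ι K : Type*} [Fintype ι] [DecidableEq ι] [CommRing K]
    (A : Matrix ι ι K) : MvPolynomial ι K :=
  (Matrix.diagonal (fun i => (MvPolynomial.X i : MvPolynomial ι K)) + A.map MvPolynomial.C).det

/-- `A` and `B` are diagonally equivalent if `A = D B D⁻¹` or `A = D Bᵀ D⁻¹` for an invertible
diagonal matrix `D`. -/
def DiagEquiv {ι K : Type*} [Fintype ι] [DecidableEq ι] [Field K] (A B : Matrix ι ι K) : Prop :=
  ∃ d : ι → K, (∀ i, d i ≠ 0) ∧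
    (A = Matrix.diagonal d * B * Matrix.diagonal (fun i => (d i)⁻¹) ∨
      A = Matrix.diagonal d * B.transpose * Matrix.diagonal (fun i => (d i)⁻¹))

/-- `A` is reducible if, after a simultaneous permutation of rows and columns, it is block upper
triangular with two (nonempty) diagonal blocks. The map `b` tells in which block an index is put;
sorting the indices by their value under `b` is the permutation. (More than two blocks can be
merged into two.) -/
def IsReducible {ι K : Type*} [Zero K] (A : Matrix ι ι K) : Prop :=
  ∃ b : ι → Fin 2, Function.Surjective b ∧ A.BlockTriangular b

/-- `A` is irreducible if it is of positive size and not reducible. -/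
def IsIrreducible {ι K : Type*} [Zero K] (A : Matrix ι ι K) : Prop :=
  Nonempty ι ∧ ¬ IsReducible A

/-- After a simultaneous permutation of rows and columns (sorting by the block label `b`), `A` is
block upper triangular with `s` diagonal blocks, all of them irreducible. -/
def IsBlockUpperTriangular {ι K : Type*} [Zero K] {s : ℕ} (A : Matrix ι ι K) (b : ι → Fin s) :
    Prop :=
  Function.Surjective b ∧ A.BlockTriangular b ∧ ∀ k, IsIrreducible (A.toSquareBlock b k)

/-- After a simultaneous permutation of rows and columns (sorting by the block label `b`), `A` is
block diagonal with `s` diagonal blocks, all of them irreducible: `A` is completely reducible. -/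
def IsCompletelyReducible {ι K : Type*} [Zero K] {s : ℕ} (A : Matrix ι ι K) (b : ι → Fin s) :
    Prop :=
  Function.Surjective b ∧ (∀ i j, b i ≠ b j → A i j = 0) ∧
    ∀ k, IsIrreducible (A.toSquareBlock b k)

/-- The determinantal polynomial of the `k`-th diagonal block of `A`, in the variables `x_i` with
`i` in that block, seen as a polynomial in all the variables. -/
noncomputable def blockPoly {ι K : Type*} [Fintype ι] [DecidableEq ι] [CommRing K] {s : ℕ}
    (A : Matrix ι ι K) (b : ι → Fin s) (k : Fin s) : MvPolynomial ι K :=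
  MvPolynomial.rename (Subtype.val : {i // b i = k} → ι) (detPoly (A.toSquareBlock b k))

end PrincipalMinors

/-!
A matrix in the fiber of a Hermitian matrix `A` has the same diagonal and the same products
`B i j * B j i = |A i j| ^ 2` as `A`. The digraph of `B` (its nonzero off-diagonal entries) thus
contains the graph of `A`, and the only further arcs are one-way: their opposite entry is zero.
The proof rests on the weight `|B i j| / |B j i|`, which is `0` precisely on one-way arcs, and on
the fact that it multiplies to `1` along *every* closed walk of the digraph of `B`
(`asymmetry_closedWalk_eq_one`).

A shortest closed walk of weight different from `1` would be a chordless cycle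
(`weight_eq_one_of_chordless`). On such a cycle, of length at least three, the principal minors of
`A` and `B` differ only in the contribution of its two rotations (`det_sub_det_of_cycle`), so the
products of `B` along them have the same sum and the same product as those of `A`. The latter are
complex conjugates, so the former have equal absolute value, which means weight `1`.

Consequently no directed cycle of `B` contains a one-way arc. If `A` is irreducible, its graph is
connected, so the weights of walks from a root define a positive diagonal matrix that conjugates
`B` to a Hermitian matrix (`exists_isHermitian_diagEquiv`). In general, reachability in the digraph
of `B` is a partial order on the connected components of `A`, and a linear extension of it puts `B`
in block triangular form with one irreducible block for each component of `A`
(`exists_blockTriangular`); the irreducible case applies to each block.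

Principal minors are the coefficients of the determinantal polynomial, so fibers are its level
sets. It is affine in each variable; a proper factorization would split the variables into two
sets, and comparing coefficients would give `A i j * A j i = 0` for all `i`, `j` in different sets
(`irreducible_detPoly`).
-/

namespace PrincipalMinors

/-! ### Principal minors as coefficients of the determinantal polynomial -/

section DetPoly

open MvPolynomial Finset

variable {ι K : Type*} [DecidableEq ι] [CommRing K]

lemma principalMinorMap_empty (A : Matrix ι ι K) : principalMinorMap A ∅ = 1 := by
  simp [principalMinorMap]

lemma principalMinorMap_image {κ : Type*} [Fintype κ] [DecidableEq κ] (A : Matrix ι ι K)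
    (v : κ → ι) (hv : Function.Injective v) :
    (A.submatrix v v).det = principalMinorMap A (univ.image v) := by
  have hmem : ∀ i, v i ∈ univ.image v := fun i => mem_image_of_mem v (mem_univ i)
  let e : κ ≃ (univ.image v : Finset ι) := Equiv.ofBijective (fun i => ⟨v i, hmem i⟩)
    ⟨fun i j h => hv (congrArg Subtype.val h), fun ⟨x, hx⟩ => by
      obtain ⟨i, -, rfl⟩ := mem_image.1 hx; exact ⟨i, rfl⟩⟩
  rw [principalMinorMap, ← Matrix.det_submatrix_equiv_self e]
  rfl

lemma det_submatrix_eq_of_mem_fiber {κ : Type*} [Fintype κ] [DecidableEq κ] {A B : Matrix ι ι K}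
    (h : B ∈ fiber A) (v : κ → ι) (hv : Function.Injective v) :
    (B.submatrix v v).det = (A.submatrix v v).det := by
  rw [principalMinorMap_image _ v hv, principalMinorMap_image _ v hv]
  exact congrFun h _

lemma submatrix_mem_fiber {κ : Type*} [Fintype κ] [DecidableEq κ] {A B : Matrix ι ι K}
    (h : B ∈ fiber A) (v : κ → ι) (hv : Function.Injective v) :
    B.submatrix v v ∈ fiber (A.submatrix v v) := by
  refine funext fun s => ?_
  simp only [principalMinorMap, Matrix.submatrix_submatrix]
  exact det_submatrix_eq_of_mem_fiber h _ (hv.comp Subtype.val_injective)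

lemma diag_eq_of_mem_fiber {A B : Matrix ι ι K} (h : B ∈ fiber A) (i : ι) : B i i = A i i := by
  simpa using det_submatrix_eq_of_mem_fiber h (fun _ : Unit => i) (fun _ _ _ => rfl)

lemma mul_swap_eq_of_mem_fiber {A B : Matrix ι ι K} (h : B ∈ fiber A) (i j : ι) :
    B i j * B j i = A i j * A j i := by
  by_cases hij : i = j
  · subst hij; rw [diag_eq_of_mem_fiber h]
  have := det_submatrix_eq_of_mem_fiber h ![i, j] (by
    intro a b; fin_cases a <;> fin_cases b <;> simp [hij, Ne.symm hij])
  simp only [Matrix.det_fin_two, Matrix.submatrix_apply, Matrix.cons_val_zero,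
    Matrix.cons_val_one, diag_eq_of_mem_fiber h] at this
  exact sub_right_injective this

/-- The exponent vector of the squarefree monomial `∏ i ∈ s, X i`. -/
noncomputable def squarefreeExp (s : Finset ι) : ι →₀ ℕ := ∑ i ∈ s, Finsupp.single i 1

lemma squarefreeExp_apply (s : Finset ι) (i : ι) :
    squarefreeExp s i = if i ∈ s then 1 else 0 := by
  simp [squarefreeExp, Finsupp.finsetSum_apply, Finsupp.single_apply]

lemma squarefreeExp_injective : Function.Injective (squarefreeExp (ι := ι)) := by
  intro s t h
  ext i
  have := DFunLike.congr_fun h i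
  simp only [squarefreeExp_apply] at this
  by_cases hs : i ∈ s <;> by_cases ht : i ∈ t <;> simp_all

variable [Fintype ι]

/-- The determinantal polynomial is the generating function of the principal minors: in the
row-multilinear expansion of `det (diag x + A)`, choosing the diagonal in the rows of `s` leaves
the principal minor on the complement of `s`. -/
lemma detPoly_eq_sum (A : Matrix ι ι K) :
    detPoly A = ∑ s : Finset ι, monomial (squarefreeExp s) (principalMinorMap A sᶜ) := by
  unfold detPoly
  have h := (Matrix.detRowAlternating (n := ι) (R := MvPolynomial ι K)).map_add_univ
    (Matrix.diagonal (fun i => (X i : MvPolynomial ι K))) (A.map C)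
  refine h.trans (Finset.sum_congr rfl fun s _ => ?_)
  change Matrix.det (Matrix.of (s.piecewise (Matrix.diagonal fun i => (X i : MvPolynomial ι K))
    (A.map C))) = _
  have h1 : Matrix.of (s.piecewise (Matrix.diagonal fun i => (X i : MvPolynomial ι K)) (A.map C))
      = Matrix.of fun i j => (if i ∈ s then (X i : MvPolynomial ι K) else 1) *
          (Matrix.of (sᶜ.piecewise A.row (1 : Matrix ι ι K).row)).map C i j := by
    ext1 i j
    by_cases hi : i ∈ s
    · rcases eq_or_ne i j with rfl | hij <;> simp [*, Matrix.row, Finset.piecewise]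
    · simp [hi, Matrix.row, Finset.piecewise]
  rw [h1, Matrix.det_mul_column, ← RingHom.mapMatrix_apply, ← RingHom.map_det,
    Matrix.det_piecewise_one_eq_submatrix_det, Finset.prod_ite_mem, Finset.univ_inter,
    mul_comm, squarefreeExp]
  have h2 : (∏ i ∈ s, (X i : MvPolynomial ι K)) = monomial (∑ i ∈ s, Finsupp.single i 1) 1 := by
    rw [monomial_sum_one]; rfl
  rw [h2, C_mul_monomial, mul_one]
  rfl

lemma coeff_detPoly (A : Matrix ι ι K) (s : Finset ι) :
    coeff (squarefreeExp s) (detPoly A) = principalMinorMap A sᶜ := by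
  rw [detPoly_eq_sum, coeff_sum, Finset.sum_eq_single s]
  · simp
  · intro t _ hts
    rw [coeff_monomial, if_neg fun h => hts (squarefreeExp_injective h)]
  · simp

theorem mem_fiber_iff_detPoly_eq {A B : Matrix ι ι K} :
    B ∈ fiber A ↔ detPoly B = detPoly A := by
  constructor
  · intro h
    rw [detPoly_eq_sum, detPoly_eq_sum, show principalMinorMap B = principalMinorMap A from h]
  · intro h
    refine funext fun s => ?_
    rw [← compl_compl s, ← coeff_detPoly, ← coeff_detPoly, h]

lemma degreeOf_detPoly_le (A : Matrix ι ι K) (i : ι) : degreeOf i (detPoly A) ≤ 1 := by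
  rw [degreeOf_le_iff, detPoly_eq_sum]
  intro m hm
  rw [mem_support_iff, coeff_sum] at hm
  obtain ⟨s, -, hs⟩ := Finset.exists_ne_zero_of_sum_ne_zero hm
  rw [coeff_monomial] at hs
  have : squarefreeExp s = m := by by_contra h; simp [h] at hs
  rw [← this, squarefreeExp_apply]
  split_ifs <;> omega

end DetPoly

/-! ### Diagonal equivalence -/

section DiagEquiv

variable {ι K : Type*} [Fintype ι] [DecidableEq ι] [Field K]

/-- Diagonal similarity and transposition preserve every principal minor. -/
lemma DiagEquiv.mem_fiber {A B : Matrix ι ι K} (h : DiagEquiv A B) : A ∈ fiber B := by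
  obtain ⟨d, hd, h⟩ := h
  have key : ∀ M : Matrix ι ι K,
      Matrix.diagonal d * M * Matrix.diagonal (fun i => (d i)⁻¹) ∈ fiber M := by
    intro M
    refine funext fun s => ?_
    have : (Matrix.diagonal d * M * Matrix.diagonal (fun i => (d i)⁻¹)).submatrix
        (Subtype.val : s → ι) Subtype.val = Matrix.diagonal (fun i : s => d i) *
          M.submatrix Subtype.val Subtype.val * Matrix.diagonal (fun i : s => (d i)⁻¹) := by
      ext i j
      simp [Matrix.mul_diagonal, Matrix.diagonal_mul]
    rw [principalMinorMap, this, Matrix.det_mul, Matrix.det_mul, Matrix.det_diagonal,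
      Matrix.det_diagonal, mul_right_comm, ← Finset.prod_mul_distrib]
    simp [hd, principalMinorMap]
  rcases h with rfl | rfl
  · exact key B
  · refine (key B.transpose).trans (funext fun s => ?_)
    rw [principalMinorMap, ← Matrix.transpose_submatrix, Matrix.det_transpose]
    rfl

end DiagEquiv

/-! ### Irreducibility of the determinantal polynomial -/

section Irreducible

open MvPolynomial Finset

variable {ι K : Type*} [Field K]

/-- If `g` and `h` involve disjoint sets of variables, the product has no cancellation. -/
lemma coeff_add_mul_of_disjoint {S : Set ι} {g h : MvPolynomial ι K} {u v : ι →₀ ℕ}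
    (hg : ∀ m ∈ g.support, ∀ i ∉ S, m i = 0) (hh : ∀ m ∈ h.support, ∀ i ∈ S, m i = 0)
    (hu : ∀ i ∉ S, u i = 0) (hv : ∀ i ∈ S, v i = 0) :
    coeff (u + v) (g * h) = coeff u g * coeff v h := by
  classical
  rw [coeff_mul, Finset.sum_eq_single (u, v)]
  · rintro ⟨p, q⟩ hpq hne
    rw [Finset.HasAntidiagonal.mem_antidiagonal] at hpq
    by_contra hnz
    have hp := hg p (by rw [mem_support_iff]; exact left_ne_zero_of_mul hnz)
    have hq := hh q (by rw [mem_support_iff]; exact right_ne_zero_of_mul hnz)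
    apply hne
    have hpu : p = u := by
      ext i
      have := DFunLike.congr_fun hpq i
      simp only [Finsupp.add_apply] at this
      by_cases hi : i ∈ S
      · rw [hq i hi, hv i hi] at this; simpa using this
      · rw [hp i hi, hu i hi]
    subst hpu
    simpa using hpq
  · simp

lemma isUnit_of_support_eq_zero {g : MvPolynomial ι K} (hg0 : g ≠ 0)
    (hg : ∀ m ∈ g.support, ∀ i, m i = 0) : IsUnit g := by
  classical
  have h : g = C (coeff 0 g) := by
    ext m
    rw [coeff_C]
    split_ifs with hm
    · rw [hm]
    · by_contra hne
      exact hm (Finsupp.ext fun i => by simp [hg m (mem_support_iff.2 hne) i])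
  rw [h, isUnit_map_iff, isUnit_iff_ne_zero]
  intro h0
  rw [h0, C_0] at h
  exact hg0 h

lemma irreducible_rename {κ : Type*} {f : κ → ι} (hf : Function.Injective f)
    {p : MvPolynomial κ K} (hp : Irreducible p) : Irreducible (rename f p) := by
  classical
  have hinj := rename_injective (R := K) f hf
  refine ⟨fun hu => hp.not_isUnit ?_, fun g h hgh => ?_⟩
  · have := hu.map (killCompl (R := K) hf)
    rwa [killCompl_rename_app] at this
  have hne : rename f p ≠ 0 := fun h0 => hp.ne_zero (hinj (by simpa using h0))
  have hg0 : g ≠ 0 := by rintro rfl; simp [hgh] at hne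
  have hh0 : h ≠ 0 := by rintro rfl; simp [hgh] at hne
  have hvars : ∀ i, i ∈ g.vars ∨ i ∈ h.vars → i ∈ Set.range f := by
    intro i hi
    have h1 : i ∈ (rename f p).vars := by
      rw [hgh]
      by_contra hcon
      have h0 : degreeOf i (g * h) = 0 := by
        rw [degreeOf_def, Multiset.count_eq_zero]
        simpa [vars_def] using hcon
      rw [degreeOf_mul_eq hg0 hh0] at h0
      have h2 : ∀ q : MvPolynomial ι K, degreeOf i q = 0 → i ∉ q.vars := by
        intro q hq
        rw [degreeOf_def, Multiset.count_eq_zero] at hq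
        simpa [vars_def] using hq
      rcases hi with hi | hi
      · exact h2 g (by omega) hi
      · exact h2 h (by omega) hi
    have := vars_rename f p h1
    simp only [mem_image] at this
    obtain ⟨k, -, hk⟩ := this
    exact ⟨k, hk⟩
  obtain ⟨g, rfl⟩ := exists_rename_eq_of_vars_subset_range g f hf fun i hi => hvars i (Or.inl hi)
  obtain ⟨h, rfl⟩ := exists_rename_eq_of_vars_subset_range h f hf fun i hi => hvars i (Or.inr hi)
  rw [← map_mul] at hgh
  exact (hp.isUnit_or_isUnit (hinj hgh)).imp (fun u => u.map (rename f)) fun u => u.map (rename f)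

variable [Fintype ι] [DecidableEq ι]

/-- In a factorization `detPoly A = g * h` every variable occurs in exactly one factor, so the
coefficients multiply: comparing those that give the minors on `∅`, `{i}`, `{j}`, `{i, j}`, with
`i` a variable of `g` and `j` one of `h`, yields `A i j * A j i = 0`. -/
theorem irreducible_detPoly [Nonempty ι] (A : Matrix ι ι K)
    (hA : ∀ S : Set ι, S.Nonempty → Sᶜ.Nonempty → ∃ i ∈ S, ∃ j ∉ S, A i j * A j i ≠ 0) :
    Irreducible (detPoly A) := by
  classical
  have hlead : coeff (squarefreeExp univ) (detPoly A) = 1 := by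
    rw [coeff_detPoly, compl_univ, principalMinorMap_empty]
  have hf0 : detPoly A ≠ 0 := fun h => by simp [h] at hlead
  refine ⟨fun hu => ?_, fun g h hgh => ?_⟩
  · obtain ⟨c, -, hc⟩ := isUnit_iff_eq_C_of_isReduced.1 hu
    rw [hc, coeff_C, if_neg] at hlead
    · exact zero_ne_one hlead
    · intro h0
      have := DFunLike.congr_fun h0 (Classical.arbitrary ι)
      simp [squarefreeExp_apply] at this
  have hg0 : g ≠ 0 := by rintro rfl; simp [hgh] at hf0
  have hh0 : h ≠ 0 := by rintro rfl; simp [hgh] at hf0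
  have hdeg : ∀ i, degreeOf i g + degreeOf i h ≤ 1 := fun i => by
    rw [← degreeOf_mul_eq hg0 hh0, ← hgh]; exact degreeOf_detPoly_le A i
  set S : Set ι := {i | degreeOf i g ≠ 0} with hS
  have hgS : ∀ m ∈ g.support, ∀ i ∉ S, m i = 0 := fun m hm i hi => by
    have h1 := monomial_le_degreeOf i hm
    have h2 : degreeOf i g = 0 := by simpa [hS] using hi
    omega
  have hhS : ∀ m ∈ h.support, ∀ i ∈ S, m i = 0 := fun m hm i hi => by
    have h1 := monomial_le_degreeOf i hm
    have h2 : degreeOf i g ≠ 0 := hi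
    have h3 := hdeg i
    omega
  rcases S.eq_empty_or_nonempty with hE | hne
  · left
    exact isUnit_of_support_eq_zero hg0 fun m hm i => hgS m hm i (by simp [hE])
  rcases Sᶜ.eq_empty_or_nonempty with hE | hne'
  · right
    refine isUnit_of_support_eq_zero hh0 fun m hm i => hhS m hm i ?_
    rw [Set.compl_empty_iff] at hE
    simp [hE]
  exfalso
  obtain ⟨i, hi, j, hj, hij⟩ := hA S hne hne'
  have hne_ij : i ≠ j := by rintro rfl; exact hj hi
  -- the coefficient of the monomial missing exactly the variables of `t`
  have key : ∀ t : Finset ι, principalMinorMap A t =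
      coeff (squarefreeExp (S.toFinset \ t)) g * coeff (squarefreeExp (Sᶜ.toFinset \ t)) h := by
    intro t
    rw [← coeff_add_mul_of_disjoint hgS hhS, ← hgh, ← compl_compl t, ← coeff_detPoly]
    · congr 1
      ext k
      by_cases hk : k ∈ S <;> by_cases hkt : k ∈ t <;> simp [squarefreeExp_apply, hk, hkt]
    · intro k hk; simp [squarefreeExp_apply, hk]
    · intro k hk; simp [squarefreeExp_apply, hk]
  have k0 := key ∅
  have ki := key {i}
  have kj := key {j}
  have kij := key {i, j}
  have e1 : Sᶜ.toFinset \ {i} = Sᶜ.toFinset := by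
    rw [Finset.sdiff_singleton_eq_erase, Finset.erase_eq_of_notMem]; simpa using hi
  have e2 : S.toFinset \ {j} = S.toFinset := by
    rw [Finset.sdiff_singleton_eq_erase, Finset.erase_eq_of_notMem]; simpa using hj
  have e3 : S.toFinset \ {i, j} = S.toFinset \ {i} := by
    ext k; simp only [mem_sdiff, Set.mem_toFinset, mem_insert, mem_singleton]
    constructor
    · tauto
    · rintro ⟨h1, h2⟩; exact ⟨h1, by rintro (h | rfl); exacts [h2 h, hj h1]⟩
  have e4 : Sᶜ.toFinset \ {i, j} = Sᶜ.toFinset \ {j} := by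
    ext k; simp only [mem_sdiff, Set.mem_toFinset, mem_insert, mem_singleton, Set.mem_compl_iff]
    constructor
    · tauto
    · rintro ⟨h1, h2⟩; exact ⟨h1, by rintro (rfl | h); exacts [h1 hi, h2 h]⟩
  rw [principalMinorMap_empty, sdiff_empty, sdiff_empty] at k0
  rw [e1] at ki
  rw [e2] at kj
  rw [e3, e4] at kij
  have m1 : ∀ k, principalMinorMap A {k} = A k k := fun k => by
    have := principalMinorMap_image A (fun _ : Unit => k) (fun _ _ _ => rfl)
    simpa using this.symm
  have m2 : principalMinorMap A {i, j} = A i i * A j j - A i j * A j i := by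
    have := principalMinorMap_image A ![i, j] (by
      intro a b; fin_cases a <;> fin_cases b <;> simp [hne_ij, Ne.symm hne_ij])
    rw [Matrix.det_fin_two] at this
    have hu : (univ : Finset (Fin 2)) = {0, 1} := rfl
    simpa [hu, image_insert] using this.symm
  rw [m1] at ki kj
  rw [m2] at kij
  apply hij
  linear_combination (-1 : K) * kij + A j j * ki +
    coeff (squarefreeExp (S.toFinset \ {i})) g * coeff (squarefreeExp Sᶜ.toFinset) h * kj -
    coeff (squarefreeExp (S.toFinset \ {i})) g *
      coeff (squarefreeExp (Sᶜ.toFinset \ {j})) h * k0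

end Irreducible

open Finset Equiv Relation

/-! ### Determinants of matrices supported on a cycle -/

section CycleDet

variable {κ K : Type*}

/-- A permutation that moves every point by at most one step along the transitive rotation `c`, and
moves some point forward without moving its successor back, is `c` itself: injectivity leaves no
room to stop or to turn round later. -/
lemma eq_of_forward_step {c σ : Perm κ} (hc : ∀ i j, ∃ k : ℕ, (c ^ k) i = j)
    (hfix : ∀ i, c i ≠ i) (hσ : ∀ i, σ i = i ∨ σ i = c i ∨ c (σ i) = i) {i₀ : κ}
    (h0 : σ i₀ = c i₀) (h1 : σ (c i₀) ≠ i₀) : σ = c := by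
  have key : ∀ k : ℕ, σ ((c ^ k) i₀) = c ((c ^ k) i₀) ∧ σ (c ((c ^ k) i₀)) ≠ (c ^ k) i₀ := by
    intro k
    induction k with
    | zero => exact ⟨h0, h1⟩
    | succ k ih =>
      obtain ⟨ih1, ih2⟩ := ih
      rw [pow_succ', Perm.mul_apply]
      set x := (c ^ k) i₀
      have hs : σ (c x) = c (c x) := by
        rcases hσ (c x) with h | h | h
        · exact absurd (σ.injective (h.trans ih1.symm)) (hfix x)
        · exact h
        · exact absurd (c.injective h) ih2
      exact ⟨hs, fun h => ih2 (hs.trans (σ.injective (h.trans ih1.symm)))⟩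
  ext i
  obtain ⟨k, rfl⟩ := hc i₀ i
  exact (key k).1

lemma exists_inv_pow_apply_eq {c : Perm κ} (hc : ∀ i j, ∃ k : ℕ, (c ^ k) i = j) (i j : κ) :
    ∃ k : ℕ, (c⁻¹ ^ k) i = j := by
  obtain ⟨k, hk⟩ := hc j i
  exact ⟨k, by rw [inv_pow, Perm.inv_eq_iff_eq, hk]⟩

/-- The permutations supported on a cycle graph are its two rotations and involutions. -/
lemma eq_or_eq_inv_or_involutive {c σ : Perm κ} (hc : ∀ i j, ∃ k : ℕ, (c ^ k) i = j)
    (hfix : ∀ i, c i ≠ i) (hσ : ∀ i, σ i = i ∨ σ i = c i ∨ c (σ i) = i) :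
    σ = c ∨ σ = c⁻¹ ∨ ∀ i, σ (σ i) = i := by
  by_cases hinv : ∀ i, σ (σ i) = i
  · exact Or.inr (Or.inr hinv)
  push Not at hinv
  obtain ⟨i, hi⟩ := hinv
  rcases hσ i with h | h | h
  · exact absurd (by rw [h, h]) hi
  · left
    exact eq_of_forward_step hc hfix hσ h (by rwa [h] at hi)
  · right; left
    have h' : σ i = c⁻¹ i := Perm.eq_inv_iff_eq.2 h
    refine eq_of_forward_step (exists_inv_pow_apply_eq hc) (fun j hj => ?_) (fun j => ?_) h'
      (by rwa [h'] at hi)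
    · rw [Perm.inv_eq_iff_eq] at hj
      exact hfix j hj.symm
    · rcases hσ j with h | h | h
      · exact Or.inl h
      · exact Or.inr (Or.inr (by rw [h, ← Perm.mul_apply, inv_mul_cancel, Perm.one_apply]))
      · exact Or.inr (Or.inl (Perm.eq_inv_iff_eq.2 h))

variable [Fintype κ] [Field K]

/-- Along an involution only diagonal entries and products of opposite entries matter. -/
lemma prod_eq_prod_of_involutive {M N : Matrix κ κ K} (hd : ∀ i, M i i = N i i)
    (ho : ∀ i j, M i j * M j i = N i j * N j i) {σ : κ → κ} (hσ : ∀ i, σ (σ i) = i) :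
    ∏ i, M (σ i) i = ∏ i, N (σ i) i := by
  by_cases hN : ∃ i, N (σ i) i * N i (σ i) = 0
  · obtain ⟨i, hi⟩ := hN
    have zero : ∀ P : Matrix κ κ K, P (σ i) i * P i (σ i) = 0 → ∏ i, P (σ i) i = 0 := by
      intro P hP
      rcases mul_eq_zero.1 hP with h | h
      · exact Finset.prod_eq_zero (mem_univ i) h
      · exact Finset.prod_eq_zero (mem_univ (σ i)) (by rw [hσ, h])
    rw [zero N hi, zero M (by rw [ho, hi])]
  push Not at hN
  have hN1 : ∀ i, N (σ i) i ≠ 0 := fun i => left_ne_zero_of_mul (hN i)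
  rw [← div_eq_one_iff_eq (Finset.prod_ne_zero_iff.2 fun i _ => hN1 i), ← Finset.prod_div_distrib]
  refine Finset.prod_involution (fun i _ => σ i) (fun i _ => ?_) (fun i _ h1 h2 => ?_)
    (fun i _ => mem_univ _) (fun i _ => hσ i)
  · rw [hσ, div_mul_div_comm, ho, div_self (hN i)]
  · apply h1
    rw [h2, hd, div_self]
    simpa only [h2] using hN1 i

variable [DecidableEq κ]

/-- Two matrices supported on a cycle graph with at least three vertices, with equal diagonals and
equal products of opposite entries: in the difference of their determinants only the two
rotations of the cycle survive. -/
theorem det_sub_det_of_cycle {c : Perm κ} (hc : ∀ i j, ∃ k : ℕ, (c ^ k) i = j)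
    (hfix : ∀ i, c i ≠ i) (hcc : c ≠ c⁻¹) {M N : Matrix κ κ K}
    (hM : ∀ i j, M i j ≠ 0 → j = i ∨ j = c i ∨ i = c j)
    (hN : ∀ i j, N i j ≠ 0 → j = i ∨ j = c i ∨ i = c j)
    (hd : ∀ i, M i i = N i i) (ho : ∀ i j, M i j * M j i = N i j * N j i) :
    M.det - N.det = (Perm.sign c : ℤ) *
      ((∏ i, M i (c i) + ∏ i, M (c i) i) - (∏ i, N i (c i) + ∏ i, N (c i) i)) := by
  have hinv : ∀ P : Matrix κ κ K, ∏ i, P (c⁻¹ i) i = ∏ i, P i (c i) := fun P => by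
    rw [← Equiv.prod_comp c]; simp
  rw [Matrix.det_apply', Matrix.det_apply', ← Finset.sum_sub_distrib,
    Finset.sum_eq_add c c⁻¹ hcc]
  · rw [Perm.sign_inv, hinv, hinv]; ring
  · rintro σ - ⟨h1, h2⟩
    by_cases hσ : ∀ i, σ i = i ∨ σ i = c i ∨ c (σ i) = i
    · rcases eq_or_eq_inv_or_involutive hc hfix hσ with h | h | h
      · exact absurd h h1
      · exact absurd h h2
      · rw [prod_eq_prod_of_involutive hd ho h, sub_self]
    · push Not at hσ
      obtain ⟨i, ha, hb, hc'⟩ := hσ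
      have zero : ∀ P : Matrix κ κ K, (∀ i j, P i j ≠ 0 → j = i ∨ j = c i ∨ i = c j) →
          ∏ i, P (σ i) i = 0 := fun P hP => by
        refine Finset.prod_eq_zero (mem_univ i) ?_
        by_contra hne
        rcases hP _ _ hne with h | h | h
        · exact ha h.symm
        · exact hc' h.symm
        · exact hb h
      rw [zero M hM, zero N hN, sub_self]
  · simp
  · simp

end CycleDet

/-! ### Closed walks in weighted digraphs -/

section ClosedWalk

variable {ι W : Type*} [CommMonoid W]

/-- `HasWalk R w n x y a`: there is a walk `x → ⋯ → y` with `n` steps along the arcs of the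
relation `R`, and `a` is the product of the weights `w` of its arcs. -/
def HasWalk (R : ι → ι → Prop) (w : ι → ι → W) (n : ℕ) (x y : ι) (a : W) : Prop :=
  ∃ v : ℕ → ι, v 0 = x ∧ v n = y ∧ (∀ i < n, R (v i) (v (i + 1))) ∧
    a = ∏ i ∈ range n, w (v i) (v (i + 1))

variable {R : ι → ι → Prop} {w : ι → ι → W}

lemma HasWalk.of_rel {x y : ι} (h : R x y) : HasWalk R w 1 x y (w x y) :=
  ⟨fun i => if i = 0 then x else y, by simp, by simp, by simpa using h, by simp⟩

lemma HasWalk.trans {m n : ℕ} {x y z : ι} {a b : W} (h₁ : HasWalk R w m x y a)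
    (h₂ : HasWalk R w n y z b) : HasWalk R w (m + n) x z (a * b) := by
  obtain ⟨u, rfl, rfl, hu, rfl⟩ := h₁
  obtain ⟨v, hv0, rfl, hv, rfl⟩ := h₂
  have e1 : ∀ i ≤ m, (if i ≤ m then u i else v (i - m)) = u i := fun i hi => if_pos hi
  have e2 : ∀ i, (if m + i ≤ m then u (m + i) else v (m + i - m)) = v i := fun i => by
    rcases Nat.eq_zero_or_pos i with rfl | hi
    · simp [hv0]
    · rw [if_neg (by omega), Nat.add_sub_cancel_left]
  refine ⟨fun i => if i ≤ m then u i else v (i - m), e1 0 (by omega), e2 n, fun i hi => ?_, ?_⟩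
  · by_cases him : i < m
    · have := hu i him
      simp only [e1 i him.le, e1 (i + 1) him]
      exact this
    · obtain ⟨k, rfl⟩ := Nat.exists_eq_add_of_le (not_lt.1 him)
      simp only [add_assoc, e2]
      exact hv k (by omega)
  · rw [Finset.prod_range_add]
    congr 1
    · refine Finset.prod_congr rfl fun i hi => ?_
      have := mem_range.1 hi
      simp only [e1 i this.le, e1 (i + 1) this]
    · refine Finset.prod_congr rfl fun i _ => ?_
      simp only [add_assoc, e2]

lemma HasWalk.segment {n : ℕ} {v : ℕ → ι} (hv : ∀ i < n, R (v i) (v (i + 1))) {p q : ℕ}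
    (hpq : p ≤ q) (hq : q ≤ n) :
    HasWalk R w (q - p) (v p) (v q) (∏ i ∈ Ico p q, w (v i) (v (i + 1))) := by
  refine ⟨fun i => v (p + i), by simp, by simp [hpq], fun i hi => hv (p + i) (by omega), ?_⟩
  rw [Finset.prod_Ico_eq_prod_range]
  rfl

lemma exists_hasWalk_of_reflTransGen {x y : ι} (h : Relation.ReflTransGen R x y) :
    ∃ n a, HasWalk R w n x y a := by
  induction h with
  | refl => exact ⟨0, 1, fun _ => x, rfl, rfl, by simp, by simp⟩
  | tail _ hbc ih =>
    obtain ⟨n, a, h⟩ := ih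
    exact ⟨n + 1, _, h.trans (.of_rel hbc)⟩

/-- Chordless closed walks suffice: if all chordless cycles of length at least three have weight
`1`, then so does every closed walk. A shortest counterexample `v` has no chord `v p → v q`: one
of the two closed walks it cuts off shows that the weight of the chord is a unit, so that the
chord can be reversed, and then both are shorter closed walks whose weights multiply to that
of `v`. -/
theorem weight_eq_one_of_chordless (hirr : ∀ i, ¬ R i i)
    (hunit : ∀ i j, R i j → IsUnit (w i j) → R j i)
    (hsymm : ∀ i j, R i j → R j i → w i j * w j i = 1)
    (hcyc : ∀ (k : ℕ) (v : Fin (k + 3) → ι), Function.Injective v →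
      (∀ i, R (v i) (v (finRotate _ i))) →
      (∀ i j, R (v i) (v j) → j = finRotate _ i ∨ i = finRotate _ j) →
      ∏ i, w (v i) (v (finRotate _ i)) = 1)
    {n : ℕ} {x : ι} {a : W} (h : HasWalk R w n x x a) : a = 1 := by
  induction n using Nat.strong_induction_on generalizing x a with
  | _ n ih =>
  obtain ⟨v, rfl, hclose, hv, rfl⟩ := h
  let P : ℕ → ℕ → W := fun p q => ∏ i ∈ Ico p q, w (v i) (v (i + 1))
  have seg : ∀ {p q : ℕ}, p ≤ q → q ≤ n → HasWalk R w (q - p) (v p) (v q) (P p q) :=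
    fun hpq hq => HasWalk.segment hv hpq hq
  have split : ∀ {p q : ℕ}, p ≤ q → q ≤ n →
      ∏ i ∈ range n, w (v i) (v (i + 1)) = P q n * P 0 p * P p q := by
    intro p q hpq hq
    rw [range_eq_Ico, ← Finset.prod_Ico_consecutive _ (Nat.zero_le p) (hpq.trans hq),
      ← Finset.prod_Ico_consecutive _ hpq hq]
    change P 0 p * (P p q * P q n) = _
    rw [mul_comm (P p q), ← mul_assoc, mul_comm (P 0 p)]
  -- the part of the closed walk outside `[p, q]`, from `v q` round to `v p`
  have outer : ∀ {p q : ℕ}, p ≤ q → q ≤ n →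
      HasWalk R w (n - q + p) (v q) (v p) (P q n * P 0 p) := by
    intro p q hpq hq
    have h1 := seg hq le_rfl
    rw [hclose] at h1
    exact h1.trans (seg (Nat.zero_le p) (hpq.trans hq))
  by_cases hinj : ∃ p q, p < q ∧ q < n ∧ v p = v q
  · obtain ⟨p, q, hpq, hq, heq⟩ := hinj
    have h1 := seg hpq.le hq.le
    have h2 := outer hpq.le hq.le
    rw [heq] at h1 h2
    rw [split hpq.le hq.le, ih _ (by omega) h1, ih _ (by omega) h2, mul_one]
  by_cases hchord : ∃ p q, p < q ∧ q < n ∧ (R (v p) (v q) ∨ R (v q) (v p)) ∧ q ≠ p + 1 ∧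
      ¬ (p = 0 ∧ q + 1 = n)
  · obtain ⟨p, q, hpq, hq, hR, h1, h2⟩ := hchord
    have c1 : R (v q) (v p) →
        P p q * w (v q) (v p) = 1 := fun hr =>
      ih _ (by omega) ((seg hpq.le hq.le).trans (.of_rel hr))
    have c2 : R (v p) (v q) → P q n * P 0 p * w (v p) (v q) = 1 := fun hr =>
      ih _ (by omega) ((outer hpq.le hq.le).trans (.of_rel hr))
    have hboth : R (v p) (v q) ∧ R (v q) (v p) := by
      rcases hR with hr | hr
      · exact ⟨hr, hunit _ _ hr (IsUnit.of_mul_eq_one_right _ (c2 hr))⟩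
      · exact ⟨hunit _ _ hr (IsUnit.of_mul_eq_one_right _ (c1 hr)), hr⟩
    rw [split hpq.le hq.le, ← mul_one (_ * P p q), ← hsymm _ _ hboth.1 hboth.2, mul_mul_mul_comm,
      c1 hboth.2, c2 hboth.1, mul_one, hsymm _ _ hboth.1 hboth.2]
  push Not at hinj hchord
  match n, hclose, hv, hinj, hchord with
  | 0, _, _, _, _ => simp
  | 1, hclose, hv, _, _ =>
    have := hv 0 zero_lt_one
    rw [zero_add, hclose] at this
    exact absurd this (hirr _)
  | 2, hclose, hv, _, _ =>
    have h0 := hv 0 (by omega)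
    have h1 := hv 1 (by omega)
    simp only [zero_add, Nat.reduceAdd] at h0 h1
    rw [hclose] at h1
    simp [Finset.prod_range_succ, hclose, hsymm _ _ h0 h1]
  | k + 3, hclose, hv, hinj, hchord =>
    have hrot : ∀ i : Fin (k + 3), v (finRotate _ i : Fin (k + 3)) = v (i + 1) := by
      intro i
      rw [coe_finRotate]
      split_ifs with hi
      · rw [hi, Fin.val_last, hclose]
      · rfl
    rw [Finset.prod_range]
    have hstep : ∀ p q : Fin (k + 3), (q : ℕ) = p + 1 → q = finRotate _ p := by
      intro p q h
      apply Fin.ext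
      rw [coe_finRotate, if_neg, h]
      rintro rfl
      simp only [Fin.val_last] at h
      omega
    have hwrap : ∀ p q : Fin (k + 3), (p : ℕ) = 0 → (q : ℕ) + 1 = k + 3 →
        p = finRotate _ q := by
      intro p q hp hq
      apply Fin.ext
      rw [coe_finRotate, if_pos, hp]
      exact Fin.ext (by simp only [Fin.val_last]; omega)
    have hlt : ∀ p q : Fin (k + 3), p < q → (R (v p) (v q) ∨ R (v q) (v p)) →
        q = finRotate _ p ∨ p = finRotate _ q := by
      intro p q hpq hR
      by_cases h : (q : ℕ) = p + 1
      · exact Or.inl (hstep p q h)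
      · have := hchord p q hpq q.2 hR h
        exact Or.inr (hwrap p q this.1 this.2)
    have := hcyc k (fun i => v i) (fun p q h => ?_) (fun i => ?_) (fun p q h => ?_)
    · simpa only [hrot] using this
    · rcases lt_trichotomy p q with hpq | hpq | hpq
      · exact absurd h (hinj p q hpq q.2)
      · exact hpq
      · exact absurd h.symm (hinj q p hpq p.2)
    · simp only [hrot]
      exact hv i i.2
    · rcases lt_trichotomy p q with hpq | rfl | hpq
      · exact hlt p q hpq (Or.inl h)
      · exact absurd h (hirr _)
      · exact (hlt q p hpq (Or.inr h)).symm

end ClosedWalk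

lemma eq_conj_of_mul_eq_of_norm_eq {x y : ℂ} {r : ℝ} (hr : 0 ≤ r) (hxy : x * y = r)
    (hn : ‖x‖ = ‖y‖) : star y = x := by
  by_cases hy : y = 0
  · rw [hy, norm_zero, norm_eq_zero] at hn
    rw [hn, hy, star_zero]
  · have h1 : r = ‖y‖ * ‖y‖ := by
      have := congrArg norm hxy
      rw [norm_mul, hn, Complex.norm_real, Real.norm_of_nonneg hr] at this
      exact this.symm
    apply mul_right_cancel₀ hy
    rw [hxy, h1, Complex.star_def, mul_comm, Complex.mul_conj, Complex.normSq_eq_norm_sq, sq]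

/-! ### The fiber of a Hermitian matrix -/

section Support

/-- The arcs of the digraph of a matrix: its nonzero off-diagonal entries. -/
def Arc {ι K : Type*} [Zero K] (M : Matrix ι ι K) (i j : ι) : Prop := i ≠ j ∧ M i j ≠ 0

variable {ι : Type*}

lemma reflTransGen_arc_of_ne_zero {K : Type*} [Zero K] {M : Matrix ι ι K} {i j : ι}
    (h : M i j ≠ 0) : ReflTransGen (Arc M) i j := by
  by_cases hij : i = j
  · rw [hij]
  · exact .single ⟨hij, h⟩

lemma mul_swap_eq_normSq {A : Matrix ι ι ℂ} (hA : A.IsHermitian) (i j : ι) :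
    A i j * A j i = ((‖A i j‖ ^ 2 : ℝ) : ℂ) := by
  rw [← hA.apply j i, Complex.star_def, Complex.mul_conj, Complex.normSq_eq_norm_sq]

lemma arc_symm_of_isHermitian {A : Matrix ι ι ℂ} (hA : A.IsHermitian) {i j : ι}
    (h : Arc A i j) : Arc A j i :=
  ⟨h.1.symm, fun h0 => h.2 (by rw [← hA.apply i j, h0, star_zero])⟩

variable [DecidableEq ι] {A B : Matrix ι ι ℂ}

lemma arc_of_mem_fiber (hA : A.IsHermitian) (hB : B ∈ fiber A) {i j : ι} (h : Arc A i j) :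
    Arc B i j := by
  refine ⟨h.1, left_ne_zero_of_mul (b := B j i) ?_⟩
  rw [mul_swap_eq_of_mem_fiber hB]
  exact mul_ne_zero h.2 (arc_symm_of_isHermitian hA h).2

lemma arc_of_arc_of_arc (hB : B ∈ fiber A) {i j : ι} (h : Arc B i j)
    (h' : Arc B j i) : Arc A i j := by
  refine ⟨h.1, left_ne_zero_of_mul (b := A j i) ?_⟩
  rw [← mul_swap_eq_of_mem_fiber hB]
  exact mul_ne_zero h.2 h'.2

/-- The ratio `|B i j| / |B j i|`, which measures how far `B` is from being Hermitian. Division by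
zero makes it vanish when the entry `B i j` has zero opposite entry. -/
noncomputable def asymmetry (B : Matrix ι ι ℂ) (i j : ι) : ℝ := ‖B i j‖ / ‖B j i‖

/-- On a chordless cycle of `B` the determinant determines the sum, and the `2 × 2` minors the
product, of the products `p`, `q` along the two rotations. Hence `p`, `q` are the corresponding
products for `A`, which are complex conjugates. -/
lemma prod_asymmetry_eq_one_of_chordless (hA : A.IsHermitian) (hB : B ∈ fiber A) {k : ℕ}
    {v : Fin (k + 3) → ι} (hv : Function.Injective v)
    (hstep : ∀ i, Arc B (v i) (v (finRotate _ i)))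
    (hchord : ∀ i j, Arc B (v i) (v j) → j = finRotate _ i ∨ i = finRotate _ j) :
    ∏ i, asymmetry B (v i) (v (finRotate _ i)) = 1 := by
  set c := finRotate (k + 3) with hc
  have hfix : ∀ i, c i ≠ i := fun i => by
    have : i ∈ Perm.support c := by rw [hc, support_finRotate]; exact mem_univ i
    exact Perm.mem_support.1 this
  have htrans : ∀ i j, ∃ m : ℕ, (c ^ m) i = j := fun i j =>
    isCycle_finRotate.exists_pow_eq (hfix i) (hfix j)
  have hcc : c ≠ c⁻¹ := by
    intro h
    have h1 : c (c 0) = 0 := by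
      conv_lhs => rw [h]
      rw [← h, ← Perm.eq_inv_iff_eq, ← h]
    have h2 : ((c (c 0) : Fin (k + 3)) : ℕ) = 2 := by
      rw [hc, coe_finRotate_of_ne_last, coe_finRotate_of_ne_last]
      · simp
      · intro h; have := congrArg Fin.val h; simp at this
      · intro h
        have := congrArg Fin.val h
        rw [coe_finRotate_of_ne_last] at this
        · simp at this
        · intro h; have := congrArg Fin.val h; simp at this
    rw [h1] at h2
    simp at h2
  have hM : ∀ i j, B.submatrix v v i j ≠ 0 → j = i ∨ j = c i ∨ i = c j := fun i j h => by
    by_cases hij : j = i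
    · exact Or.inl hij
    · exact Or.inr (hchord i j ⟨fun h' => hij (hv h').symm, h⟩)
  have hN : ∀ i j, A.submatrix v v i j ≠ 0 → j = i ∨ j = c i ∨ i = c j := fun i j h => by
    by_cases hij : j = i
    · exact Or.inl hij
    · exact Or.inr (hchord i j (arc_of_mem_fiber hA hB ⟨fun h' => hij (hv h').symm, h⟩))
  have hdet := det_sub_det_of_cycle htrans hfix hcc hM hN
    (fun i => diag_eq_of_mem_fiber hB (v i)) (fun i j => mul_swap_eq_of_mem_fiber hB (v i) (v j))
  rw [det_submatrix_eq_of_mem_fiber hB v hv, sub_self, eq_comm, mul_eq_zero,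
    or_iff_right (by simp), sub_eq_zero] at hdet
  simp only [Matrix.submatrix_apply] at hdet
  set p := ∏ i, B (v i) (v (c i)) with hp
  set q := ∏ i, B (v (c i)) (v i) with hq
  set α := ∏ i, A (v i) (v (c i)) with hα
  have hβ : ∏ i, A (v (c i)) (v i) = star α := by
    rw [hα, star_prod]
    exact Finset.prod_congr rfl fun i _ => (hA.apply _ _).symm
  rw [hβ] at hdet
  have hpq : p * q = α * star α := by
    rw [← hβ, hp, hq, hα, ← Finset.prod_mul_distrib, ← Finset.prod_mul_distrib]
    exact Finset.prod_congr rfl fun i _ => mul_swap_eq_of_mem_fiber hB _ _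
  have hp0 : p ≠ 0 := Finset.prod_ne_zero_iff.2 fun i _ => (hstep i).2
  have hnorm : ‖p‖ = ‖q‖ := by
    have h0 : (p - α) * (p - star α) = 0 := by linear_combination p * hdet - hpq
    rcases mul_eq_zero.1 h0 with h | h
    · rw [sub_eq_zero] at h
      rw [show q = star α by linear_combination hdet - h, h, norm_star]
    · rw [sub_eq_zero] at h
      rw [show q = α by linear_combination hdet - h, h, norm_star]
  simp only [asymmetry]
  rw [Finset.prod_div_distrib, ← norm_prod, ← norm_prod, ← hp, ← hq, ← hnorm,
    div_self (norm_ne_zero_iff.2 hp0)]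

/-- The asymmetry of `B` multiplies to `1` along every closed walk of its digraph. -/
theorem asymmetry_closedWalk_eq_one (hA : A.IsHermitian) (hB : B ∈ fiber A) {n : ℕ} {x : ι}
    {a : ℝ} (h : HasWalk (Arc B) (asymmetry B) n x x a) : a = 1 := by
  have hunit : ∀ i j, Arc B i j → IsUnit (asymmetry B i j) → Arc B j i := fun i j h hu =>
    ⟨h.1.symm, fun h0 => hu.ne_zero (by simp [asymmetry, h0])⟩
  have hsymm : ∀ i j, Arc B i j → Arc B j i → asymmetry B i j * asymmetry B j i = 1 := by
    intro i j h h'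
    have h1 := norm_ne_zero_iff.2 h.2
    have h2 := norm_ne_zero_iff.2 h'.2
    simp only [asymmetry]
    field_simp
  exact weight_eq_one_of_chordless (fun i h => h.1 rfl) hunit hsymm
    (fun _ _ hv => prod_asymmetry_eq_one_of_chordless hA hB hv) h

/-- An arc on a directed cycle of `B` is also an arc of `A`: a zero opposite entry would make the
asymmetry along the cycle vanish. -/
lemma arc_of_arc_of_reflTransGen (hA : A.IsHermitian) (hB : B ∈ fiber A) {i j : ι}
    (h : Arc B i j) (hr : ReflTransGen (Arc B) j i) : Arc A i j := by
  obtain ⟨n, a, hw⟩ := exists_hasWalk_of_reflTransGen (w := asymmetry B) hr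
  have h1 := asymmetry_closedWalk_eq_one hA hB ((HasWalk.of_rel h).trans hw)
  refine arc_of_arc_of_arc hB h ⟨h.1.symm, fun h0 => ?_⟩
  simp [asymmetry, h0] at h1

variable [Fintype ι]

/-- The weights of walks from a root to the indices give a positive diagonal matrix; conjugating
`B` with its square root makes opposite entries of equal absolute value, hence conjugate, as
their product is nonnegative. -/
theorem exists_isHermitian_diagEquiv [Nonempty ι] (hA : A.IsHermitian) (hB : B ∈ fiber A)
    (hconn : ∀ i j, ReflTransGen (Arc A) i j) :
    ∃ H : Matrix ι ι ℂ, H.IsHermitian ∧ (∀ i j, Arc A i j → Arc H i j) ∧ DiagEquiv B H := by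
  have hconnB : ∀ i j, ReflTransGen (Arc B) i j := fun i j =>
    ReflTransGen.mono (r := Arc A) (fun _ _ => arc_of_mem_fiber hA hB) i j (hconn i j)
  let r : ι := Classical.arbitrary ι
  choose n d hd using fun i => exists_hasWalk_of_reflTransGen (w := asymmetry B) (hconnB r i)
  choose m e he using fun i => exists_hasWalk_of_reflTransGen (w := asymmetry B) (hconnB i r)
  have hde : ∀ i, d i * e i = 1 := fun i =>
    asymmetry_closedWalk_eq_one hA hB ((hd i).trans (he i))
  have hdpos : ∀ i, 0 < d i := by
    intro i
    have h0 : 0 ≤ d i := by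
      obtain ⟨v, -, -, -, h⟩ := hd i
      rw [h]
      exact Finset.prod_nonneg fun _ _ => div_nonneg (norm_nonneg _) (norm_nonneg _)
    exact lt_of_le_of_ne h0 fun h => by simpa [← h] using hde i
  have hbal : ∀ i j, d i * ‖B i j‖ = d j * ‖B j i‖ := by
    have harc : ∀ i j, Arc B i j → d i * ‖B i j‖ = d j * ‖B j i‖ := by
      intro i j h
      have hA' := arc_symm_of_isHermitian hA (arc_of_arc_of_reflTransGen hA hB h (hconnB j i))
      have h2 := norm_ne_zero_iff.2 (arc_of_mem_fiber hA hB hA').2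
      have h1 : d i * asymmetry B i j * e j = 1 :=
        asymmetry_closedWalk_eq_one hA hB (((hd i).trans (.of_rel h)).trans (he j))
      have h3 : asymmetry B i j * ‖B j i‖ = ‖B i j‖ := div_mul_cancel₀ _ h2
      rw [← h3]
      linear_combination d j * ‖B j i‖ * h1 - d i * asymmetry B i j * ‖B j i‖ * hde j
    intro i j
    by_cases hij : i = j
    · rw [hij]
    by_cases h1 : B i j = 0
    · by_cases h2 : B j i = 0
      · rw [h1, h2, norm_zero, mul_zero, mul_zero]
      · exact (harc j i ⟨Ne.symm hij, h2⟩).symm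
    · exact harc i j ⟨hij, h1⟩
  let s : ι → ℝ := fun i => √(d i)
  have hs : ∀ i, 0 < s i := fun i => Real.sqrt_pos.2 (hdpos i)
  have hs0 : ∀ i, (s i : ℂ) ≠ 0 := fun i => Complex.ofReal_ne_zero.2 (hs i).ne'
  have hss : ∀ i, s i * s i = d i := fun i => Real.mul_self_sqrt (hdpos i).le
  refine ⟨Matrix.of fun i j => s i * B i j * (s j : ℂ)⁻¹, ?_, fun i j h => ⟨h.1, ?_⟩,
    fun i => (s i : ℂ)⁻¹, fun i => inv_ne_zero (hs0 i), Or.inl ?_⟩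
  · refine Matrix.IsHermitian.ext fun i j => ?_
    simp only [Matrix.of_apply]
    refine eq_conj_of_mul_eq_of_norm_eq (sq_nonneg ‖A i j‖) ?_ ?_
    · rw [← mul_swap_eq_normSq hA, ← mul_swap_eq_of_mem_fiber hB]
      have := hs0 i
      have := hs0 j
      field_simp
    · simp only [norm_mul, norm_inv, Complex.norm_real, Real.norm_of_nonneg (hs _).le]
      have h1 := (hs i).ne'
      have h2 := (hs j).ne'
      have h3 := hbal i j
      rw [← hss, ← hss] at h3
      field_simp
      linear_combination h3
  · exact mul_ne_zero (mul_ne_zero (hs0 i) (arc_of_mem_fiber hA hB h).2) (inv_ne_zero (hs0 j))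
  · ext i j
    have := hs0 i
    have := hs0 j
    simp only [Matrix.mul_diagonal, Matrix.diagonal_mul, Matrix.of_apply]
    field_simp

end Support

/-! ### Irreducibility as strong connectivity -/

section Connectivity

variable {ι K : Type*} [Zero K]

/-- A matrix is irreducible if and only if its digraph is strongly connected. -/
theorem isIrreducible_iff {M : Matrix ι ι K} :
    IsIrreducible M ↔ Nonempty ι ∧ ∀ i j, ReflTransGen (Arc M) i j := by
  classical
  refine and_congr_right fun _ => ⟨fun h i j => ?_, fun h => ?_⟩
  · by_contra hij
    -- the indices that can be reached from `i` form the second block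
    refine h ⟨fun x => if ReflTransGen (Arc M) i x then 1 else 0, fun k => ?_, fun x y hxy => ?_⟩
    · fin_cases k
      · exact ⟨j, if_neg hij⟩
      · exact ⟨i, if_pos .refl⟩
    · by_contra hne
      by_cases hx : ReflTransGen (Arc M) i x
      · have hy := hx.trans (reflTransGen_arc_of_ne_zero hne)
        simp [hx, hy] at hxy
      · simp [hx] at hxy
  · rintro ⟨b, hb, htri⟩
    obtain ⟨i, hi⟩ := hb 1
    obtain ⟨j, hj⟩ := hb 0
    have hmono : ∀ y, ReflTransGen (Arc M) i y → b i ≤ b y := by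
      intro y hy
      induction hy with
      | refl => exact le_rfl
      | tail _ hbc ih => exact ih.trans (not_lt.1 fun hlt => hbc.2 (htri hlt))
    have := hmono j (h i j)
    rw [hi, hj] at this
    exact absurd this (by decide)

lemma IsIrreducible.of_arc {M N : Matrix ι ι K} (hM : IsIrreducible M)
    (h : ∀ i j, Arc M i j → Arc N i j) : IsIrreducible N := by
  rw [isIrreducible_iff] at hM ⊢
  exact ⟨hM.1, fun i j => ReflTransGen.mono (r := Arc M) h i j (hM.2 i j)⟩

/-- The diagonal blocks cut out by the classes of mutually reachable indices are irreducible. -/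
lemma isIrreducible_toSquareBlock {α : Type*} {M : Matrix ι ι K} {b : ι → α}
    (hb : ∀ i j, b i = b j ↔ ReflTransGen (Arc M) i j) (hsurj : Function.Surjective b) (k : α) :
    IsIrreducible (M.toSquareBlock b k) := by
  obtain ⟨i₀, hi₀⟩ := hsurj k
  refine isIrreducible_iff.2 ⟨⟨i₀, hi₀⟩, ?_⟩
  rintro ⟨i, hi⟩ ⟨j, hj⟩
  have hij := (hb i j).1 (hi.trans hj.symm)
  induction hij using ReflTransGen.head_induction_on with
  | refl => exact .refl
  | head hac _ ih =>
    have hc := ((hb _ _).2 (.single hac)).symm.trans hi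
    have harc : Arc (M.toSquareBlock b k) ⟨_, hi⟩ ⟨_, hc⟩ :=
      ⟨fun h => hac.1 (congrArg Subtype.val h), hac.2⟩
    exact .head harc (ih hc)

end Connectivity

/-! ### Block polynomials -/

section Blocks

open MvPolynomial in
lemma detPoly_eq_prod_blockPoly {ι K : Type*} [Fintype ι] [DecidableEq ι] [CommRing K] {s : ℕ}
    {M : Matrix ι ι K} {b : ι → Fin s} (hM : M.BlockTriangular b) :
    detPoly M = ∏ k, blockPoly M b k := by
  have h : (Matrix.diagonal (fun i => (X i : MvPolynomial ι K)) + M.map C).BlockTriangular b := by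
    intro i j hij
    have hne : i ≠ j := by rintro rfl; exact lt_irrefl _ hij
    simp [hne, hM hij]
  rw [detPoly, h.det_fintype]
  refine Finset.prod_congr rfl fun k _ => ?_
  rw [blockPoly, detPoly, AlgHom.map_det]
  congr 1
  ext1 i j
  rcases eq_or_ne i j with rfl | hij
  · simp [Matrix.toSquareBlock_def]
  · simp [Matrix.toSquareBlock_def, hij, Subtype.val_injective.ne hij]

lemma blockPoly_perm_comp {ι K : Type*} [Fintype ι] [DecidableEq ι] [CommRing K] {s : ℕ}
    (M : Matrix ι ι K) (a : ι → Fin s) (e : Perm (Fin s)) (k : Fin s) :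
    blockPoly M (e ∘ a) k = blockPoly M a (e.symm k) := by
  let P : (p : ι → Prop) → [DecidablePred p] → MvPolynomial ι K := fun p _ =>
    MvPolynomial.rename Subtype.val (detPoly (M.toSquareBlockProp p))
  have key : ∀ (p q : ι → Prop) [DecidablePred p] [DecidablePred q], p = q → P p = P q := by
    rintro p q _ _ rfl
    congr!
  exact key (fun i => (e ∘ a) i = k) (fun i => a i = e.symm k)
    (funext fun i => propext (Equiv.eq_symm_apply e).symm)

lemma blockPoly_eq_of_mem_fiber {ι K : Type*} [Fintype ι] [DecidableEq ι] [CommRing K] {s : ℕ}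
    {A B : Matrix ι ι K} (hB : B ∈ fiber A) (b : ι → Fin s) (k : Fin s) :
    blockPoly B b k = blockPoly A b k := by
  have h : B.toSquareBlock b k ∈ fiber (A.toSquareBlock b k) :=
    submatrix_mem_fiber hB _ Subtype.val_injective
  rw [blockPoly, blockPoly, mem_fiber_iff_detPoly_eq.1 h]

/-- A finite partial order has a monotone enumeration (a topological sort). -/
lemma exists_equiv_fin_monotone {α : Type*} [Fintype α] {s : ℕ} (hs : Fintype.card α = s)
    (r : α → α → Prop) (hr : IsPartialOrder α r) :
    ∃ e : α ≃ Fin s, ∀ x y, r x y → e x ≤ e y := by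
  classical
  let _ : PartialOrder α :=
    { le := r
      le_refl := hr.refl
      le_trans := hr.trans
      le_antisymm := hr.antisymm }
  have : Fintype (LinearExtension α) := inferInstanceAs (Fintype α)
  let f : Fin s ≃o LinearExtension α := monoEquivOfFin (LinearExtension α) (by
    rw [← hs]; exact Fintype.card_congr (Equiv.refl α))
  exact ⟨f.symm.toEquiv, fun x y h =>
    f.symm.monotone (toLinearExtension.monotone (show x ≤ y from h))⟩

end Blocks

/-! ### Components of a Hermitian matrix -/

section Hermitian

variable {ι : Type*} {A B : Matrix ι ι ℂ}

lemma IsIrreducible.exists_mul_ne_zero (hA : A.IsHermitian) (h : IsIrreducible A) (S : Set ι)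
    (hS : S.Nonempty) (hS' : Sᶜ.Nonempty) : ∃ i ∈ S, ∃ j ∉ S, A i j * A j i ≠ 0 := by
  obtain ⟨x, hx⟩ := hS
  obtain ⟨y, hy⟩ := hS'
  by_contra! hcon
  have : ∀ z, ReflTransGen (Arc A) x z → z ∈ S := by
    intro z hz
    induction hz with
    | refl => exact hx
    | tail _ hbc ih =>
      by_contra hc
      exact mul_ne_zero hbc.2 (arc_symm_of_isHermitian hA hbc).2 (hcon _ ih _ hc)
  exact hy (this y ((isIrreducible_iff.1 h).2 x y))

lemma exists_components [Fintype ι] (hA : A.IsHermitian) :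
    ∃ (s : ℕ) (a : ι → Fin s), Function.Surjective a ∧
      ∀ i j, a i = a j ↔ ReflTransGen (Arc A) i j := by
  classical
  have : Std.Symm (Arc A) := ⟨fun _ _ => arc_symm_of_isHermitian hA⟩
  let S : Setoid ι := ⟨ReflTransGen (Arc A), fun _ => .refl,
    fun h => ReflTransGen.stdSymm.symm _ _ h, .trans⟩
  refine ⟨Fintype.card (Quotient S), fun i => Fintype.equivFin _ (Quotient.mk S i),
    (Fintype.equivFin _).surjective.comp Quotient.mk_surjective, fun i j => ?_⟩
  rw [EmbeddingLike.apply_eq_iff_eq, Quotient.eq]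
  rfl

variable [DecidableEq ι]

/-- Two indices on a common directed cycle of `B` lie in the same component of `A`. -/
lemma reflTransGen_arc_of_mutual (hA : A.IsHermitian) (hB : B ∈ fiber A) {x y : ι}
    (hxy : ReflTransGen (Arc B) x y) (hyx : ReflTransGen (Arc B) y x) :
    ReflTransGen (Arc A) x y := by
  induction hxy using ReflTransGen.head_induction_on with
  | refl => exact .refl
  | head hac hcy ih =>
    exact .head (arc_of_arc_of_reflTransGen hA hB hac (hcy.trans hyx)) (ih (hyx.tail hac))

/-- The components of `A`, ordered suitably, put `B` in block triangular form: reachability in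
the digraph of `B` is a partial order on them. -/
lemma exists_blockTriangular (hA : A.IsHermitian) (hB : B ∈ fiber A) {s : ℕ} {a : ι → Fin s}
    (hsurj : Function.Surjective a) (ha : ∀ i j, a i = a j ↔ ReflTransGen (Arc A) i j) :
    ∃ e : Perm (Fin s), B.BlockTriangular (e ∘ a) := by
  have hAB : ∀ {i j}, a i = a j → ReflTransGen (Arc B) i j := fun {i j} h =>
    ReflTransGen.mono (r := Arc A) (fun _ _ => arc_of_mem_fiber hA hB) i j ((ha i j).1 h)
  let r : Fin s → Fin s → Prop := fun k l => ∃ i j, a i = k ∧ a j = l ∧ ReflTransGen (Arc B) i j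
  have hr : IsPartialOrder (Fin s) r :=
    { refl := fun k => by
        obtain ⟨i, hi⟩ := hsurj k
        exact ⟨i, i, hi, hi, .refl⟩
      trans := by
        rintro k l m ⟨i, j, rfl, rfl, hij⟩ ⟨i', j', hi', rfl, hij'⟩
        exact ⟨i, j', rfl, rfl, (hij.trans (hAB hi'.symm)).trans hij'⟩
      antisymm := by
        rintro k l ⟨i, j, rfl, rfl, hij⟩ ⟨j', i', hj', hi', hji⟩
        exact (ha i j).2 (reflTransGen_arc_of_mutual hA hB hij
          (((hAB hj'.symm).trans hji).trans (hAB hi'))) }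
  obtain ⟨e, he⟩ := exists_equiv_fin_monotone (Fintype.card_fin s) r hr
  refine ⟨e, fun i j hij => ?_⟩
  by_contra hne
  exact absurd hij (not_lt.2 (he _ _ ⟨i, j, rfl, rfl, reflTransGen_arc_of_ne_zero hne⟩))

variable [Fintype ι]

theorem IsIrreducible.irreducible_detPoly (hA : A.IsHermitian) (h : IsIrreducible A) :
    Irreducible (detPoly A) :=
  have := h.1
  PrincipalMinors.irreducible_detPoly A (h.exists_mul_ne_zero hA)

theorem IsIrreducible.mem_fiber_iff (hA : A.IsHermitian) (h : IsIrreducible A) :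
    B ∈ fiber A ↔ ∃ H : Matrix ι ι ℂ, H.IsHermitian ∧ IsIrreducible H ∧ H ∈ fiber A ∧
      DiagEquiv B H := by
  constructor
  · intro hB
    have := h.1
    obtain ⟨H, hH, harc, hBH⟩ := exists_isHermitian_diagEquiv hA hB (isIrreducible_iff.1 h).2
    have hmem : principalMinorMap B = principalMinorMap H := hBH.mem_fiber
    exact ⟨H, hH, h.of_arc harc, hmem.symm.trans hB, hBH⟩
  · rintro ⟨H, -, -, hHA, hBH⟩
    exact Eq.trans (hBH.mem_fiber : principalMinorMap B = principalMinorMap H) hHA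

theorem mem_fiber_iff_blocks (hA : A.IsHermitian) {s : ℕ} {a : ι → Fin s}
    (hsurj : Function.Surjective a) (ha : ∀ i j, a i = a j ↔ ReflTransGen (Arc A) i j) :
    B ∈ fiber A ↔ ∃ b : ι → Fin s, IsBlockUpperTriangular B b ∧
      (∀ k, ∃ H : Matrix {i // b i = k} {i // b i = k} ℂ, H.IsHermitian ∧ IsIrreducible H ∧
        DiagEquiv (B.toSquareBlock b k) H) ∧
      ∃ π : Perm (Fin s), ∀ k, blockPoly B b k = blockPoly A a (π k) := by
  have hdiag : A.BlockTriangular a := fun i j hij => by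
    by_contra hne
    exact hij.ne' ((ha i j).2 (reflTransGen_arc_of_ne_zero hne))
  constructor
  · intro hB
    obtain ⟨e, he⟩ := exists_blockTriangular hA hB hsurj ha
    have hirr : ∀ k, IsIrreducible (A.toSquareBlock (e ∘ a) k) :=
      isIrreducible_toSquareBlock (fun i j => e.injective.eq_iff.trans (ha i j))
        (e.surjective.comp hsurj)
    have hherm : ∀ k, (A.toSquareBlock (e ∘ a) k).IsHermitian := fun k => hA.submatrix _
    have hBk : ∀ k, B.toSquareBlock (e ∘ a) k ∈ fiber (A.toSquareBlock (e ∘ a) k) := fun k =>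
      submatrix_mem_fiber hB _ Subtype.val_injective
    refine ⟨e ∘ a, ⟨e.surjective.comp hsurj, he, fun k =>
      (hirr k).of_arc fun i j => arc_of_mem_fiber (hherm k) (hBk k)⟩, fun k => ?_, e.symm,
      fun k => ?_⟩
    · obtain ⟨H, hH, hHirr, -, hBH⟩ := ((hirr k).mem_fiber_iff (hherm k)).1 (hBk k)
      exact ⟨H, hH, hHirr, hBH⟩
    · rw [blockPoly_eq_of_mem_fiber hB, blockPoly_perm_comp]
  · rintro ⟨b, ⟨-, hb, -⟩, -, π, hπ⟩
    rw [mem_fiber_iff_detPoly_eq, detPoly_eq_prod_blockPoly hb, detPoly_eq_prod_blockPoly hdiag,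
      ← Equiv.prod_comp π (blockPoly A a)]
    exact Finset.prod_congr rfl fun k _ => hπ k

end Hermitian

end PrincipalMinors

theorem theorem7p2 (n : ℕ) (hn : 4 ≤ n) (A : Matrix (Fin n) (Fin n) ℂ) (hA : A.IsHermitian) :
    (PrincipalMinors.IsIrreducible A →
      ∀ B : Matrix (Fin n) (Fin n) ℂ, B ∈ PrincipalMinors.fiber A ↔
        ∃ H : Matrix (Fin n) (Fin n) ℂ, H.IsHermitian ∧ PrincipalMinors.IsIrreducible H ∧
          H ∈ PrincipalMinors.fiber A ∧ PrincipalMinors.DiagEquiv B H) ∧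
    (¬ PrincipalMinors.IsIrreducible A →
      ∃ (s : ℕ) (a : Fin n → Fin s), 2 ≤ s ∧ PrincipalMinors.IsCompletelyReducible A a ∧
        PrincipalMinors.detPoly A = ∏ k, PrincipalMinors.blockPoly A a k ∧
        (∀ k, Irreducible (PrincipalMinors.blockPoly A a k)) ∧
        ∀ B : Matrix (Fin n) (Fin n) ℂ, B ∈ PrincipalMinors.fiber A ↔
          ∃ b : Fin n → Fin s, PrincipalMinors.IsBlockUpperTriangular B b ∧
            (∀ k, ∃ H : Matrix {i // b i = k} {i // b i = k} ℂ, H.IsHermitian ∧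
              PrincipalMinors.IsIrreducible H ∧
              PrincipalMinors.DiagEquiv (B.toSquareBlock b k) H) ∧
            ∃ π : Equiv.Perm (Fin s), ∀ k,
              PrincipalMinors.blockPoly B b k = PrincipalMinors.blockPoly A a (π k)) := by
  refine ⟨fun h B => h.mem_fiber_iff hA, fun h => ?_⟩
  obtain ⟨s, a, hsurj, ha⟩ := PrincipalMinors.exists_components hA
  have hirr : ∀ k, PrincipalMinors.IsIrreducible (A.toSquareBlock a k) :=
    PrincipalMinors.isIrreducible_toSquareBlock ha hsurj
  have hzero : ∀ i j, a i ≠ a j → A i j = 0 := fun i j hij => by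
    by_contra hne
    exact hij ((ha i j).2 (PrincipalMinors.reflTransGen_arc_of_ne_zero hne))
  refine ⟨s, a, ?_, ⟨hsurj, hzero, hirr⟩,
    PrincipalMinors.detPoly_eq_prod_blockPoly fun i j hij => hzero i j hij.ne',
    fun k => PrincipalMinors.irreducible_rename Subtype.val_injective
      ((hirr k).irreducible_detPoly (hA.submatrix _)),
    fun B => PrincipalMinors.mem_fiber_iff_blocks hA hsurj ha⟩
  by_contra hs
  have : Subsingleton (Fin s) := Fin.subsingleton_iff_le_one.2 (by omega)
  exact h (PrincipalMinors.isIrreducible_iff.2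
    ⟨⟨⟨0, by omega⟩⟩, fun i j => (ha i j).1 (Subsingleton.elim _ _)⟩)
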